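/- Throughout, $\log=\log_2$, and $U_m$ is uniform on $\{0,1\}^m$. For integers $0\le k<n$, an $(n,k)$-source is a random variable $X$ that is uniformly distributed on some subset of $\{0,1\}^n$ of size $2^k$. A function $\mathcal A:\{0,1\}^d\to\{0,1\}^d$ is adversarial if $\mathcal A(s)\ne s$ for all $s$. A function $\mathsf{nmExt}:\{0,1\}^n\times\{0,1\}^d\to\{0,1\}$ is a $(k,\epsilon)$-$t$-non-malleable extractor if for every $(n,k)$-source $X$ and all adversarial functions $\mathcal A_1,\dots,\mathcal A_t$, the distributions of $$\big(\mathsf{nmExt}(X,U_d),(\mathsf{nmExt}(X,\mathcal A_i(U_d)))_{i=1}^t,U_d\big)\quad\text{and}\quad\big(U_1,(\mathsf{nmExt}(X,\mathcal A_i(U_d)))_{i=1}^t,U_d\big)$$ have total variation distance at most $\epsilon$, where $X,U_d,U_1$ are independent and the total variation distance of two distributions is the supremum over all events of the absolute difference of their probabilities. **Theorem.** There are absolute constants $c_0\in(0,1)$, $C\in\mathbb R$, $c>0$ and $n_0\in\mathbb N$ such that the following holds. Let $n,k,d,t$ be integers with $0\le k<n$, $d\ge1$ and $1\le t\le 2^{d/2}$,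 and let $\epsilon\in(0,c_0)$. If $\mathsf{nmExt}:\{0,1\}^n\times\{0,1\}^d\to\{0,1\}$ is a $(k,\epsilon)$-$t$-non-malleable extractor, then $$d>\log(n-k)+2\log(1/\epsilon)-C$$ and $$k\ge\log d+2\log(1/\epsilon)-\log\log(1/\epsilon)+\log t-C.$$ In particular, $k=\Omega(\log\log n)$: if moreover $n\ge n_0$, then $k\ge c\log\log n$. -/

import Mathlib

namespace NMExt

/-- Bit strings of length `n`. -/
abbrev Bits (n : ℕ) : Type := Fin n → Bool

/-- Total variation distance of two (discrete) distributions on `Ω`: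
the supremum over all events `S` of the difference of their probabilities. -/
noncomputable def tvDist {Ω : Type} (p q : PMF Ω) : ℝ :=
  ⨆ S : Set Ω, |(p.toOuterMeasure S).toReal - (q.toOuterMeasure S).toReal|

/-- An `(n,k)`-source: a distribution on `{0,1}^n` that is uniform on a set of size `2^k`. -/
def IsSource {n : ℕ} (k : ℕ) (X : PMF (Bits n)) : Prop :=
  ∃ (S : Finset (Bits n)) (hS : S.Nonempty), S.card = 2 ^ k ∧ X = PMF.uniformOfFinset S hS

/-- An adversarial function on seeds: one without fixed points. -/
def IsAdversarial {d : ℕ} (A : Bits d → Bits d) : Prop :=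
  ∀ s, A s ≠ s

/-- The joint distribution of `(ext(X, U_d), (ext(X, A_i(U_d)))_i, U_d)`, where the seed `U_d` is
uniform and independent of `X`. -/
noncomputable def realDist {n d t : ℕ} (ext : Bits n → Bits d → Bool) (X : PMF (Bits n))
    (A : Fin t → Bits d → Bits d) : PMF (Bool × (Fin t → Bool) × Bits d) :=
  X.bind fun x =>
    (PMF.uniformOfFintype (Bits d)).bind fun s =>
      PMF.pure (ext x s, fun i => ext x (A i s), s)

/-- The joint distribution of `(U_1, (ext(X, A_i(U_d)))_i, U_d)`, where the bit `U_1` and the seed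
`U_d` are uniform and `X`, `U_d`, `U_1` are independent. -/
noncomputable def idealDist {n d t : ℕ} (ext : Bits n → Bits d → Bool) (X : PMF (Bits n))
    (A : Fin t → Bits d → Bits d) : PMF (Bool × (Fin t → Bool) × Bits d) :=
  X.bind fun x =>
    (PMF.uniformOfFintype (Bits d)).bind fun s =>
      (PMF.uniformOfFintype Bool).bind fun b =>
        PMF.pure (b, fun i => ext x (A i s), s)

/-- `(k, ε)`-`t`-non-malleable extractors `{0,1}^n × {0,1}^d → {0,1}`. -/
def IsNonMalleableExtractor {n d : ℕ} (k : ℕ) (ε : ℝ) (t : ℕ)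
    (ext : Bits n → Bits d → Bool) : Prop :=
  ∀ X : PMF (Bits n), IsSource k X →
    ∀ A : Fin t → Bits d → Bits d, (∀ i, IsAdversarial (A i)) →
      tvDist (realDist ext X A) (idealDist ext X A) ≤ ε

end NMExt

namespace NMExt

/-! Small total variation distance bounds predictors: averaged over the seed and the source, a guess
of the output's sign from the tampered outputs has advantage at most `2ε`. Both bounds follow by
building sources, predictors and tamperings that violate this.

Seed length needs only that the output is unbiased given the seed. Cut the seeds into `2^i` blocks
of `M = 2^(d-i)`. A Rademacher sum of length `M` exceeds `√M / 2` with probability at least `1/16`,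
so each block has a sign pattern correlating that well with a `1/16` fraction of the inputs still
alive. For `2^i` of order `n - k`, enough inputs survive all blocks to form a source of bias at
least `1 / (2√M)`; hence `n - k = O(ε² 2^d)`.

For the entropy, fix one set `S` of size `2^k`. Half of the seeds are good: no `t` other outputs
predict theirs on `S`. Products of about `t/2` good outputs are sign vectors in dimension `2^k`, and
the product of two of them runs over a symmetric difference of at most `t + 1` good seeds, so they
are nearly orthogonal. Alon's bound (`card_le_two_mul_pow`) then limits their number, and logarithms
give `t d = O(2^k ε² log(1/ε))`. The seed bound is reused to show that `2^k ε²` is not too small. -/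

/-- The sign `±1` encoded by a bit. -/
noncomputable def sgn (b : Bool) : ℝ := if b then 1 else -1

theorem sgn_eq_one_or (b : Bool) : sgn b = 1 ∨ sgn b = -1 := by
  cases b <;> simp [sgn]

/-! ### From total variation distance to predictors. -/

theorem toOuterMeasure_apply_le_one {Ω : Type} (p : PMF Ω) (E : Set Ω) :
    p.toOuterMeasure E ≤ 1 := by
  rw [PMF.toOuterMeasure_apply, ← p.tsum_coe]
  exact ENNReal.tsum_le_tsum fun x => Set.indicator_le_self _ _ x

theorem toReal_toOuterMeasure_uniformOfFinset_bind {α Ω : Type} (S : Finset α) (hS : S.Nonempty)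
    (f : α → PMF Ω) (E : Set Ω) :
    (((PMF.uniformOfFinset S hS).bind f).toOuterMeasure E).toReal =
      (∑ x ∈ S, ((f x).toOuterMeasure E).toReal) / S.card := by
  have hne : ∀ x, (f x).toOuterMeasure E ≠ ⊤ := fun x =>
    ne_top_of_le_ne_top ENNReal.one_ne_top (toOuterMeasure_apply_le_one (f x) E)
  rw [PMF.toOuterMeasure_bind_apply, tsum_eq_sum (s := S)]
  · rw [ENNReal.toReal_sum, Finset.sum_div]
    · refine Finset.sum_congr rfl fun x hx => ?_
      rw [PMF.uniformOfFinset_apply_of_mem hS hx, ENNReal.toReal_mul, ENNReal.toReal_inv,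
        ENNReal.toReal_natCast]
      ring
    · intro x hx
      refine ENNReal.mul_ne_top ?_ (hne x)
      exact (PMF.uniformOfFinset S hS).apply_ne_top x
  · intro x hx
    rw [PMF.uniformOfFinset_apply_of_notMem hS hx, zero_mul]

theorem toReal_toOuterMeasure_uniformOfFintype_bind {α Ω : Type} [Fintype α] [Nonempty α]
    (f : α → PMF Ω) (E : Set Ω) :
    (((PMF.uniformOfFintype α).bind f).toOuterMeasure E).toReal =
      (∑ x, ((f x).toOuterMeasure E).toReal) / Fintype.card α :=
  toReal_toOuterMeasure_uniformOfFinset_bind _ _ f E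

theorem toReal_toOuterMeasure_pure {Ω : Type} (a : Ω) (E : Set Ω) [Decidable (a ∈ E)] :
    ((PMF.pure a).toOuterMeasure E).toReal = if a ∈ E then 1 else 0 := by
  rw [PMF.toOuterMeasure_pure_apply]
  split_ifs <;> simp_all

theorem sub_le_tvDist {Ω : Type} (p q : PMF Ω) (S : Set Ω) :
    (p.toOuterMeasure S).toReal - (q.toOuterMeasure S).toReal ≤ tvDist p q := by
  refine (le_abs_self _).trans (le_ciSup
    (f := fun S : Set Ω => |(p.toOuterMeasure S).toReal - (q.toOuterMeasure S).toReal|) ⟨1, ?_⟩ S)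
  have h : ∀ (r : PMF Ω) (T : Set Ω), (r.toOuterMeasure T).toReal ≤ 1 := fun r T => by
    simpa using ENNReal.toReal_mono ENNReal.one_ne_top (toOuterMeasure_apply_le_one r T)
  rintro _ ⟨T, rfl⟩
  have h1 := h p T
  have h2 := h q T
  have h3 : 0 ≤ (p.toOuterMeasure T).toReal := ENNReal.toReal_nonneg
  have h4 : 0 ≤ (q.toOuterMeasure T).toReal := ENNReal.toReal_nonneg
  exact abs_le.2 ⟨by linarith, by linarith⟩

/-- Predictors that see the outputs on the tampered seeds have total advantage at most `2ε`. -/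
theorem IsNonMalleableExtractor.sum_predictor_le {n d k t : ℕ} {ε : ℝ}
    {ext : Bits n → Bits d → Bool} (h : IsNonMalleableExtractor k ε t ext)
    (S : Finset (Bits n)) (hS : S.card = 2 ^ k) (A : Bits d → Fin t → Bits d)
    (hA : ∀ s i, A s i ≠ s) (f : Bits d → (Fin t → Bool) → ℝ)
    (hf : ∀ s w, f s w = 1 ∨ f s w = -1) :
    ∑ s, ∑ x ∈ S, sgn (ext x s) * f s (fun i => ext x (A s i)) ≤ 2 * ε * 2 ^ k * 2 ^ d := by
  classical
  have hne : S.Nonempty := by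
    rw [← Finset.card_pos, hS]; positivity
  -- The event that the guess is right: probability exactly `1/2` in the ideal distribution, `1/2`
  -- plus half the advantage in the real one.
  let E : Set (Bool × (Fin t → Bool) × Bits d) := {q | sgn q.1 = f q.2.2 q.2.1}
  have key := (sub_le_tvDist _ _ E).trans
    (h (PMF.uniformOfFinset S hne) ⟨S, hne, hS, rfl⟩ (fun i s => A s i) (fun i s => hA s i))
  simp only [realDist, idealDist, toReal_toOuterMeasure_uniformOfFinset_bind,
    toReal_toOuterMeasure_uniformOfFintype_bind, toReal_toOuterMeasure_pure, hS] at key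
  have e1 : ∀ x s, (if (ext x s, (fun i => ext x (A s i)), s) ∈ E then (1 : ℝ) else 0) =
      1 / 2 + sgn (ext x s) * f s (fun i => ext x (A s i)) / 2 := by
    intro x s
    rcases sgn_eq_one_or (ext x s) with h1 | h1 <;>
      rcases hf s (fun i => ext x (A s i)) with h2 | h2 <;>
      norm_num [E, h1, h2]
  have e2 : ∀ x s, (∑ b, if (b, (fun i => ext x (A s i)), s) ∈ E then (1 : ℝ) else 0) = 1 := by
    intro x s
    rcases hf s (fun i => ext x (A s i)) with h2 | h2 <;>
      norm_num [E, h2, sgn]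
  simp only [e1, e2, Finset.sum_add_distrib, ← Finset.sum_div] at key
  simp only [Finset.sum_const, Finset.card_univ, Fintype.card_bool, Fintype.card_pi,
    Finset.prod_const, Fintype.card_fin, hS, nsmul_eq_mul] at key
  rw [Finset.sum_comm]
  push_cast at key
  have hK : (0 : ℝ) < 2 ^ k := by positivity
  have hD : (0 : ℝ) < 2 ^ d := by positivity
  field_simp at key
  linarith

/-! ### Moments and anti-concentration of Rademacher sums. -/

section Signs

theorem sum_bool_fun_succ {m : ℕ} (F : (Fin (m + 1) → Bool) → ℝ) :
    ∑ b, F b = ∑ b : Fin m → Bool, (F (Fin.cons true b) + F (Fin.cons false b)) := by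
  rw [← (Fin.consEquiv (fun _ => Bool)).sum_comp, Fintype.sum_prod_type, Fintype.sum_bool,
    ← Finset.sum_add_distrib]
  rfl

theorem sum_sgn_sq {m : ℕ} (a : Fin m → ℝ) (ha : ∀ i, a i = 1 ∨ a i = -1) :
    ∑ b : Fin m → Bool, (∑ i, sgn (b i) * a i) ^ 2 = m * 2 ^ m := by
  induction m with
  | zero => simp
  | succ m ih =>
    have h0 : a 0 ^ 2 = 1 := by rcases ha 0 with h | h <;> simp [h]
    have hc : ∑ b : Fin m → Bool, (1 : ℝ) = 2 ^ m := by simp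
    rw [sum_bool_fun_succ]
    simp only [Fin.sum_univ_succ, Fin.cons_zero, Fin.cons_succ]
    have := ih (fun i => a i.succ) (fun i => ha _)
    rw [Finset.sum_congr rfl (g := fun b : Fin m → Bool =>
      2 * (∑ i, sgn (b i) * a i.succ) ^ 2 + 2 * 1)]
    · rw [Finset.sum_add_distrib, ← Finset.mul_sum, ← Finset.mul_sum, this, hc]
      push_cast; ring
    · intro b _
      simp only [sgn, if_true, Bool.false_eq_true, if_false]
      linear_combination 2 * h0

/-- Splitting off one sign, `(z+a)⁴ + (z-a)⁴ = 2z⁴ + 12z² + 2` when `a² = 1`, and `3m² + 6m + 1 ≤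
3(m+1)²`. -/
theorem sum_sgn_pow_four_le {m : ℕ} (a : Fin m → ℝ) (ha : ∀ i, a i = 1 ∨ a i = -1) :
    ∑ b : Fin m → Bool, (∑ i, sgn (b i) * a i) ^ 4 ≤ 3 * m ^ 2 * 2 ^ m := by
  induction m with
  | zero => simp
  | succ m ih =>
    have h0 : a 0 ^ 2 = 1 := by rcases ha 0 with h | h <;> simp [h]
    have hc : ∑ b : Fin m → Bool, (1 : ℝ) = 2 ^ m := by simp
    rw [sum_bool_fun_succ]
    simp only [Fin.sum_univ_succ, Fin.cons_zero, Fin.cons_succ]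
    have h4 := ih (fun i => a i.succ) (fun i => ha _)
    have h2 := sum_sgn_sq (fun i => a (Fin.succ i)) (fun i => ha _)
    rw [Finset.sum_congr rfl (g := fun b : Fin m → Bool =>
      2 * (∑ i, sgn (b i) * a i.succ) ^ 4 + 12 * (∑ i, sgn (b i) * a i.succ) ^ 2 + 2 * 1)]
    · rw [Finset.sum_add_distrib, Finset.sum_add_distrib, ← Finset.mul_sum, ← Finset.mul_sum,
        ← Finset.mul_sum, h2, hc]
      push_cast
      have : (0 : ℝ) < 2 ^ m := by positivity
      rw [pow_succ (2 : ℝ) m]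
      nlinarith
    · intro b _
      simp only [sgn, if_true, Bool.false_eq_true, if_false]
      linear_combination (12 * (∑ i, (if b i = true then 1 else -1) * a i.succ) ^ 2 +
        2 * (a 0 ^ 2 + 1)) * h0

/-- Anti-concentration: a Rademacher sum of `m` terms is at least `√m / 2` with probability at
least `1 / 16`. -/
theorem two_pow_le_card_sgn {m : ℕ} (hm : 0 < m) (a : Fin m → ℝ)
    (ha : ∀ i, a i = 1 ∨ a i = -1) :
    (2 : ℝ) ^ m ≤ 16 *
      ∑ b : Fin m → Bool, if √m / 2 ≤ ∑ i, sgn (b i) * a i then (1 : ℝ) else 0 := by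
  have hm' : (0 : ℝ) < m := by exact_mod_cast hm
  set Z : (Fin m → Bool) → ℝ := fun b => ∑ i, sgn (b i) * a i with hZ
  have hneg : ∀ b, Z (fun i => !(b i)) = - Z b := by
    intro b
    simp only [hZ, ← Finset.sum_neg_distrib]
    refine Finset.sum_congr rfl fun i _ => ?_
    cases b i <;> simp [sgn]
  have hinv : ∑ b, (if √m / 2 ≤ - Z b then (1 : ℝ) else 0) =
      ∑ b, if √m / 2 ≤ Z b then (1 : ℝ) else 0 := by
    refine Fintype.sum_equiv (Equiv.arrowCongr (Equiv.refl _) Equiv.boolNot) _ _ fun b => ?_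
    rw [← hneg]
    rfl
  -- With `y = Z²/m` the minorant is `-(y - 1/4)(y - 7) / 12`: negative below `y = 1/4`, never above
  -- `1`. Its mean is at least `(29/4 - 3 - 7/4) / 12 = 5/24`, shared by two symmetric tails, and
  -- `5/48 > 1/16`.
  have hpt : ∀ b, (12 * m ^ 2 : ℝ)⁻¹ * (29 / 4 * m * Z b ^ 2 - Z b ^ 4 - 7 / 4 * m ^ 2 * 1) ≤
      (if √m / 2 ≤ Z b then (1 : ℝ) else 0) + if √m / 2 ≤ - Z b then (1 : ℝ) else 0 := by
    intro b
    have hs : √(m : ℝ) ^ 2 = m := Real.sq_sqrt hm'.le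
    have hs0 : 0 < √(m : ℝ) := Real.sqrt_pos.2 hm'
    rw [inv_mul_le_iff₀ (by positivity)]
    by_cases hc : √m / 2 ≤ Z b ∨ √m / 2 ≤ - Z b
    · have h1 : (1 : ℝ) ≤ (if √m / 2 ≤ Z b then (1 : ℝ) else 0) +
          if √m / 2 ≤ - Z b then (1 : ℝ) else 0 := by
        rcases hc with h | h <;> rw [if_pos h] <;> split_ifs <;> norm_num
      have h2 : (0 : ℝ) ≤ 12 * m ^ 2 := by positivity
      nlinarith [sq_nonneg (Z b ^ 2 - 29 / 8 * m)]
    · push Not at hc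
      rw [if_neg (not_le.2 hc.1), if_neg (not_le.2 hc.2)]
      have : Z b ^ 2 < m / 4 := by nlinarith [hc.1, hc.2]
      nlinarith
  have hsum := Finset.sum_le_sum fun b (_ : b ∈ Finset.univ) => hpt b
  rw [← Finset.mul_sum, Finset.sum_add_distrib, hinv, Finset.sum_sub_distrib,
    Finset.sum_sub_distrib, ← Finset.mul_sum, ← Finset.mul_sum, sum_sgn_sq a ha] at hsum
  have h4 := sum_sgn_pow_four_le a ha
  have hc : ∑ b : Fin m → Bool, (1 : ℝ) = 2 ^ m := by simp
  rw [hc, inv_mul_le_iff₀ (by positivity)] at hsum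
  set T := ∑ b, if √m / 2 ≤ Z b then (1 : ℝ) else 0
  have h5 : (m : ℝ) ^ 2 * (5 / 2 * 2 ^ m) ≤ m ^ 2 * (24 * T) := by
    nlinarith
  have := le_of_mul_le_mul_left h5 (by positivity)
  have h2m : (0 : ℝ) < 2 ^ m := by positivity
  linarith

/-- Some sign vector correlates well with a `1 / 16` fraction of a family of sign vectors. -/
theorem exists_sign_correlation {X : Type} {m : ℕ} (hm : 0 < m) (S : Finset X)
    (u : X → Fin m → ℝ) (hu : ∀ x i, u x i = 1 ∨ u x i = -1) :
    ∃ σ : Fin m → ℝ, (∀ i, σ i = 1 ∨ σ i = -1) ∧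
      S.card ≤ 16 * (S.filter fun x => √m / 2 ≤ ∑ i, σ i * u x i).card := by
  classical
  by_contra! hcon
  have h1 : ∑ x ∈ S, (2 : ℝ) ^ m ≤ ∑ x ∈ S, 16 * ∑ b : Fin m → Bool,
      if √m / 2 ≤ ∑ i, sgn (b i) * u x i then (1 : ℝ) else 0 :=
    Finset.sum_le_sum fun x _ => two_pow_le_card_sgn hm (u x) (hu x)
  rw [← Finset.mul_sum, Finset.sum_comm, Finset.mul_sum] at h1
  have h2 : ∑ b : Fin m → Bool, 16 * ∑ x ∈ S,
      (if √m / 2 ≤ ∑ i, sgn (b i) * u x i then (1 : ℝ) else 0) <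
      ∑ b : Fin m → Bool, (S.card : ℝ) := by
    refine Finset.sum_lt_sum_of_nonempty Finset.univ_nonempty fun b _ => ?_
    have := hcon (fun i => sgn (b i)) (fun i => sgn_eq_one_or _)
    rw [Finset.sum_boole]
    exact_mod_cast this
  simp only [Finset.sum_const, Finset.card_univ, Fintype.card_pi, Fintype.card_bool,
    Finset.prod_const, Fintype.card_fin, nsmul_eq_mul] at h1 h2
  push_cast at h2
  linarith

/-- Blocks are treated one at a time: each new one costs a factor `16` in the surviving set and
leaves the earlier signs unchanged. -/
theorem exists_block_sign_correlation {X ι : Type} [DecidableEq ι] {m : ℕ} (hm : 0 < m)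
    (S : Finset X) (u : X → ι → Fin m → ℝ) (hu : ∀ x j i, u x j i = 1 ∨ u x j i = -1)
    (F : Finset ι) :
    ∃ σ : ι → Fin m → ℝ, (∀ j i, σ j i = 1 ∨ σ j i = -1) ∧ ∃ S' ⊆ S,
      S.card ≤ 16 ^ F.card * S'.card ∧ ∀ x ∈ S', ∀ j ∈ F, √m / 2 ≤ ∑ i, σ j i * u x j i := by
  induction F using Finset.induction_on with
  | empty => exact ⟨fun _ _ => 1, by simp, S, subset_rfl, by simp, by simp⟩
  | insert j F hj ih =>
    obtain ⟨σ, hσ, S', hS', hcard, hcor⟩ := ih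
    obtain ⟨τ, hτ, hτc⟩ := exists_sign_correlation hm S' (fun x => u x j) (fun x => hu x j)
    refine ⟨Function.update σ j τ, ?_, S'.filter fun x => √m / 2 ≤ ∑ i, τ i * u x j i,
      (Finset.filter_subset _ _).trans hS', ?_, ?_⟩
    · intro l i
      by_cases hl : l = j
      · subst hl; simpa using hτ i
      · simpa [Function.update_of_ne hl] using hσ l i
    · rw [Finset.card_insert_of_notMem hj, pow_succ, mul_assoc]
      exact hcard.trans (Nat.mul_le_mul_left _ hτc)
    · intro x hx l hl
      rw [Finset.mem_filter] at hx
      by_cases hlj : l = j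
      · subst hlj; simpa using hx.2
      · rw [Function.update_of_ne hlj]
        exact hcor x hx.1 l (Finset.mem_of_mem_insert_of_ne hl hlj)

end Signs

/-! ### Lower bound on the seed length. -/

section SeedLength

/-- Take disjoint `K`-sets with sums `a`, `b`, `c` and write `2a = (a+b) + (a+c) - (b+c)`. Relative
to set size, the bias bound grows by a factor `3` per halving. -/
theorem sum_abs_le_of_double {X Y : Type} [Fintype X] [Fintype Y] (v : X → Y → ℝ) (K : ℕ) (B : ℝ)
    (hK : 3 * K ≤ Fintype.card X)
    (h : ∀ S : Finset X, S.card = 2 * K → ∑ y, |∑ x ∈ S, v x y| ≤ B)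
    (S : Finset X) (hS : S.card = K) : ∑ y, |∑ x ∈ S, v x y| ≤ 3 / 2 * B := by
  classical
  have hc : K + K ≤ (Finset.univ \ S).card := by
    rw [Finset.card_sdiff_of_subset (Finset.subset_univ _), Finset.card_univ]
    omega
  obtain ⟨V, hV, hVc⟩ := Finset.exists_subset_card_eq hc
  obtain ⟨S₂, hS₂, hS₂c⟩ := Finset.exists_subset_card_eq (s := V) (n := K) (by omega)
  have hdV : Disjoint S V := Finset.disjoint_sdiff.mono_right hV
  have hd2 : Disjoint S S₂ := hdV.mono_right hS₂
  have hd3 : Disjoint S (V \ S₂) := hdV.mono_right Finset.sdiff_subset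
  have hc3 : (V \ S₂).card = K := by rw [Finset.card_sdiff_of_subset hS₂]; omega
  have e1 := h (S ∪ S₂) (by rw [Finset.card_union_of_disjoint hd2]; omega)
  have e2 := h (S ∪ (V \ S₂)) (by rw [Finset.card_union_of_disjoint hd3]; omega)
  have e3 := h V (by omega)
  have hle : ∀ y, |∑ x ∈ S, v x y| ≤ 1 / 2 * (|∑ x ∈ S ∪ S₂, v x y| +
      |∑ x ∈ S ∪ (V \ S₂), v x y| + |∑ x ∈ V, v x y|) := by
    intro y
    rw [Finset.sum_union hd2, Finset.sum_union hd3, ← Finset.sum_sdiff hS₂, add_comm (∑ x ∈ V \ S₂, _)]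
    generalize ∑ x ∈ S, v x y = a
    generalize ∑ x ∈ S₂, v x y = b
    generalize ∑ x ∈ V \ S₂, v x y = c
    have t1 : 2 * a = (a + b) + (a + c) - (b + c) := by ring
    have t2 : |2 * a| ≤ |a + b| + |a + c| + |b + c| := by
      rw [t1]
      exact (abs_sub _ _).trans (by gcongr; exact abs_add_le _ _)
    rw [abs_mul, abs_two] at t2
    linarith
  have := Finset.sum_le_sum fun y (_ : y ∈ Finset.univ) => hle y
  rw [← Finset.mul_sum, Finset.sum_add_distrib, Finset.sum_add_distrib] at this
  linarith

theorem sum_abs_le_of_two_pow {n k d : ℕ} (v : Bits n → Bits d → ℝ) (η : ℝ) (hkn : k < n)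
    (h : ∀ S : Finset (Bits n), S.card = 2 ^ k → ∑ y, |∑ x ∈ S, v x y| ≤ η * 2 ^ k * 2 ^ d)
    (j : ℕ) (hj : j ≤ k) (S : Finset (Bits n)) (hS : S.card = 2 ^ (k - j)) :
    ∑ y, |∑ x ∈ S, v x y| ≤ 3 ^ j * η * 2 ^ (k - j) * 2 ^ d := by
  induction j generalizing S with
  | zero => simpa using h S hS
  | succ j ih =>
    have hkj : k - j = (k - (j + 1)) + 1 := by omega
    have hle : 3 * 2 ^ (k - (j + 1)) ≤ Fintype.card (Bits n) := by
      have : 2 ^ ((k - (j + 1)) + 2) ≤ 2 ^ n := Nat.pow_le_pow_right (by norm_num) (by omega)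
      simp only [Fintype.card_pi, Fintype.card_bool, Finset.prod_const, Finset.card_univ,
        Fintype.card_fin]
      rw [pow_add] at this
      omega
    refine (sum_abs_le_of_double v _ (3 ^ j * η * 2 ^ (k - j) * 2 ^ d) hle
      (fun T hT => ih (by omega) T (by rw [hT, hkj]; ring)) S hS).trans (le_of_eq ?_)
    rw [hkj]
    ring

/-- The condition `4 * 2^i ≤ n - k` says that losing a factor `16` on each of `2^i` blocks leaves at
least `2^k` inputs. Their bias contradicts `h` unless `1 ≤ 2η√M`. -/
theorem two_pow_le_of_balanced {n k d : ℕ} (v : Bits n → Bits d → ℝ)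
    (hv : ∀ x s, v x s = 1 ∨ v x s = -1) (η : ℝ) (hkn : k ≤ n)
    (h : ∀ S : Finset (Bits n), S.card = 2 ^ k → ∑ y, |∑ x ∈ S, v x y| ≤ η * 2 ^ k * 2 ^ d)
    (i : ℕ) (hid : i ≤ d) (hi : 4 * 2 ^ i ≤ n - k) :
    (2 : ℝ) ^ i ≤ (2 * η) ^ 2 * 2 ^ d := by
  classical
  have hcard : Fintype.card (Fin (2 ^ i) × Fin (2 ^ (d - i))) = Fintype.card (Bits d) := by
    simp [← pow_add, Nat.add_sub_cancel' hid]
  let e := Fintype.equivOfCardEq hcard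
  have hm : 0 < 2 ^ (d - i) := by positivity
  obtain ⟨σ, hσ, S', -, hS', hcor⟩ := exists_block_sign_correlation hm
    (Finset.univ : Finset (Bits n)) (fun x j l => v x (e (j, l))) (fun x j l => hv _ _)
    (Finset.univ : Finset (Fin (2 ^ i)))
  have hK : 2 ^ k ≤ S'.card := by
    simp only [Finset.card_univ, Fintype.card_pi, Fintype.card_bool, Finset.prod_const,
      Fintype.card_fin] at hS'
    have h16 : 16 ^ 2 ^ i ≤ 2 ^ (n - k) := by
      rw [show 16 = 2 ^ 4 by norm_num, ← pow_mul]
      exact Nat.pow_le_pow_right (by norm_num) hi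
    have h1 : 2 ^ (n - k) * 2 ^ k ≤ 2 ^ (n - k) * S'.card := by
      rw [← pow_add, Nat.sub_add_cancel hkn]
      exact hS'.trans (Nat.mul_le_mul_right _ h16)
    exact Nat.le_of_mul_le_mul_left h1 (by positivity)
  obtain ⟨S, hSS', hS⟩ := Finset.exists_subset_card_eq hK
  set M : ℝ := ((2 ^ (d - i) : ℕ) : ℝ) with hM
  have hlow : (2 : ℝ) ^ k * (2 ^ i * (√M / 2)) ≤ η * 2 ^ k * 2 ^ d := by
    refine le_trans ?_ (h S hS)
    calc (2 : ℝ) ^ k * (2 ^ i * (√M / 2)) = ∑ x ∈ S, ∑ j : Fin (2 ^ i), √M / 2 := by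
          simp [hS]
      _ ≤ ∑ x ∈ S, ∑ j, ∑ l, σ j l * v x (e (j, l)) :=
          Finset.sum_le_sum fun x hx => Finset.sum_le_sum fun j _ => hcor x (hSS' hx) j (by simp)
      _ = ∑ q : Fin (2 ^ i) × Fin (2 ^ (d - i)), σ q.1 q.2 * ∑ x ∈ S, v x (e q) := by
          simp only [← Fintype.sum_prod_type' (fun j l => σ j l * v _ (e (j, l)))]
          rw [Finset.sum_comm]
          simp only [Finset.mul_sum]
      _ ≤ ∑ q : Fin (2 ^ i) × Fin (2 ^ (d - i)), |∑ x ∈ S, v x (e q)| := by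
          refine Finset.sum_le_sum fun q _ => ?_
          rcases hσ q.1 q.2 with h1 | h1 <;> rw [h1]
          · rw [one_mul]; exact le_abs_self _
          · rw [neg_one_mul]; exact neg_le_abs _
      _ = ∑ y, |∑ x ∈ S, v x y| := e.sum_comp (fun y => |∑ x ∈ S, v x y|)
  have hd : (2 : ℝ) ^ d = 2 ^ i * M := by
    rw [hM]; push_cast; rw [← pow_add, Nat.add_sub_cancel' hid]
  have hM0 : 0 < M := by rw [hM]; exact_mod_cast hm
  have hsq : √M ^ 2 = M := Real.sq_sqrt hM0.le
  have hs0 : 0 < √M := Real.sqrt_pos.2 hM0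
  have h1 : 1 ≤ 2 * η * √M := by
    have h2 : (2 ^ k * 2 ^ i * √M) * 1 ≤ (2 ^ k * 2 ^ i * √M) * (2 * η * √M) := by
      rw [hd] at hlow
      have h4 : 2 ^ k * 2 ^ i * √M * (2 * η * √M) = 2 * (η * 2 ^ k * (2 ^ i * M)) := by
        linear_combination (2 * 2 ^ k * 2 ^ i * η) * hsq
      linarith
    exact le_of_mul_le_mul_left h2 (by positivity)
  have h3 : 1 ≤ (2 * η) ^ 2 * M := by nlinarith
  rw [hd]
  nlinarith [show (0 : ℝ) < 2 ^ i by positivity]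

theorem sub_le_of_balanced {n k d : ℕ} (v : Bits n → Bits d → ℝ)
    (hv : ∀ x s, v x s = 1 ∨ v x s = -1) {ε : ℝ} (hε : 0 < ε) (hε' : ε < 1 / 108) (hkn : k < n)
    (h : ∀ S : Finset (Bits n), S.card = 2 ^ k → ∑ y, |∑ x ∈ S, v x y| ≤ 2 * ε * 2 ^ k * 2 ^ d) :
    (n : ℝ) - k ≤ 93312 * ε ^ 2 * 2 ^ d := by
  -- Passing to sources of entropy `k - 3` makes the gap to `n` at least `4`, so one block is always
  -- affordable; the price is `3³ * 2ε = 54ε`. If `k < 3`, one can descend to a single point, where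
  -- the bias is total.
  have hred := sum_abs_le_of_two_pow v (2 * ε) hkn h
  have hk3 : 3 ≤ k := by
    by_contra! hk
    have h1 := hred k le_rfl {fun _ => false} (by simp)
    have h2 : ∀ y, |v (fun _ => false) y| = 1 := fun y => by
      rcases hv (fun _ => false) y with h | h <;> simp [h]
    simp only [Finset.sum_singleton, h2, Finset.sum_const, Finset.card_univ, Fintype.card_pi,
      Fintype.card_bool, Finset.prod_const, Fintype.card_fin, nsmul_eq_mul, Nat.sub_self] at h1
    push_cast at h1
    have h3 : (3 : ℝ) ^ k ≤ 3 ^ 3 := pow_le_pow_right₀ (by norm_num) hk.le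
    have h4 : (0 : ℝ) < 2 ^ d := by positivity
    have h5 : (3 : ℝ) ^ k * (2 * ε) < 1 := by nlinarith
    nlinarith
  have hblk := two_pow_le_of_balanced (k := k - 3) v hv (54 * ε) (by omega)
    (fun S hS => (hred 3 hk3 S hS).trans (le_of_eq (by ring)))
  have hD : (0 : ℝ) < 2 ^ d := by positivity
  set q := (n - (k - 3)) / 4 with hq
  have hq0 : q ≠ 0 := by omega
  have hlog := Nat.pow_log_le_self 2 hq0
  have hlog' := Nat.lt_pow_succ_log_self (b := 2) (by norm_num) q
  -- Otherwise blocks of a single seed (`i = d`) would already give `1 ≤ (108ε)²`.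
  have hid : Nat.log 2 q ≤ d := by
    by_contra! hlt
    have h1 : 2 ^ d ≤ 2 ^ Nat.log 2 q := Nat.pow_le_pow_right (by norm_num) hlt.le
    have h2 := hblk d le_rfl (by omega)
    have h3 : (2 * (54 * ε)) ^ 2 < 1 := by nlinarith
    nlinarith
  have h1 := hblk _ hid (by omega)
  have h2 : n - k ≤ 8 * 2 ^ Nat.log 2 q := by
    rw [pow_succ] at hlog'
    omega
  have h3 : ((n - k : ℕ) : ℝ) ≤ 8 * 2 ^ Nat.log 2 q := by exact_mod_cast h2
  rw [Nat.cast_sub hkn.le] at h3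
  nlinarith

end SeedLength

/-! ### Welch and Alon bounds for nearly orthogonal sign vectors. -/

section Moments

/-- The Welch bound for sign vectors in dimension `card X`, in terms of even moments. -/
theorem card_sq_mul_pow_le_choose_mul_sum {ι X : Type} [Fintype ι] [Fintype X] (w : ι → X → ℝ)
    (hw : ∀ i x, w i x = 1 ∨ w i x = -1) (p : ℕ) :
    (Fintype.card ι : ℝ) ^ 2 * ((Fintype.card X : ℝ) ^ p) ^ 2 ≤
      (Fintype.card X).multichoose p * ∑ i, ∑ j, (∑ x, w i x * w j x) ^ (2 * p) := by
  classical
  let P : ι → (Fin p → X) → ℝ := fun i f => ∏ l, w i (f l)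
  -- The tensor power `P i` depends on a tuple only through its multiset. Keeping just the pairs
  -- with equal multisets bounds the moment below, and Cauchy–Schwarz over the fibres of `μ` counts
  -- such pairs.
  let μ : (Fin p → X) → Sym X p := fun f => ⟨Multiset.map f Finset.univ.val, by simp⟩
  have hP : ∀ i f, P i f = ((μ f : Multiset X).map (w i)).prod := by
    intro i f
    simp only [P, μ, Sym.coe_mk, Multiset.map_map, Finset.prod]
    rfl
  have hP1 : ∀ i f, P i f * P i f = 1 := by
    intro i f
    simp only [P, ← Finset.prod_mul_distrib]
    refine Finset.prod_eq_one fun l _ => ?_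
    rcases hw i (f l) with h | h <;> simp [h]
  have hexp : ∑ i, ∑ j, (∑ x, w i x * w j x) ^ (2 * p) =
      ∑ f, ∑ g, (∑ i, P i f * P i g) ^ 2 := by
    have h1 : ∀ i j, (∑ x, w i x * w j x) ^ (2 * p) =
        ∑ f, ∑ g, (P i f * P i g) * (P j f * P j g) := by
      intro i j
      rw [mul_comm 2 p, pow_mul, Fintype.sum_pow, sq, Finset.sum_mul_sum]
      refine Finset.sum_congr rfl fun f _ => Finset.sum_congr rfl fun g _ => ?_
      simp only [P, Finset.prod_mul_distrib]
      ring
    simp only [h1, sq, Finset.sum_mul_sum]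
    calc _ = ∑ i, ∑ f, ∑ j, ∑ g, (P i f * P i g) * (P j f * P j g) :=
          Finset.sum_congr rfl fun i _ => Finset.sum_comm
      _ = ∑ f, ∑ i, ∑ j, ∑ g, (P i f * P i g) * (P j f * P j g) := Finset.sum_comm
      _ = ∑ f, ∑ i, ∑ g, ∑ j, (P i f * P i g) * (P j f * P j g) :=
          Finset.sum_congr rfl fun f _ => Finset.sum_congr rfl fun i _ => Finset.sum_comm
      _ = _ := Finset.sum_congr rfl fun f _ => Finset.sum_comm
  have hlow : ∀ f g, (if μ f = μ g then (Fintype.card ι : ℝ) ^ 2 else 0) ≤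
      (∑ i, P i f * P i g) ^ 2 := by
    intro f g
    split_ifs with h
    · have : ∀ i, P i f * P i g = 1 := fun i => by
        rw [hP i g, ← h, ← hP, hP1]
      simp [this]
    · positivity
  have hcount : ((Fintype.card X : ℝ) ^ p) ^ 2 ≤
      (Fintype.card X).multichoose p * ∑ f, ∑ g, if μ f = μ g then (1 : ℝ) else 0 := by
    have h1 : ∑ f, ∑ g, (if μ f = μ g then (1 : ℝ) else 0) =
        ∑ m : Sym X p, (∑ f, if μ f = m then (1 : ℝ) else 0) ^ 2 := by
      simp only [sq, Finset.sum_mul_sum]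
      conv_rhs =>
        rw [Finset.sum_comm]
        enter [2, f]
        rw [Finset.sum_comm]
      refine Finset.sum_congr rfl fun f _ => Finset.sum_congr rfl fun g _ => ?_
      rw [Finset.sum_eq_single (μ f)]
      · simp [eq_comm]
      · intro b _ hb
        simp [Ne.symm hb]
      · simp
    have h2 : ∑ m : Sym X p, (∑ f, if μ f = m then (1 : ℝ) else 0) = (Fintype.card X : ℝ) ^ p := by
      rw [Finset.sum_comm]
      simp
    rw [h1, ← h2, ← Sym.card_sym_eq_multichoose]
    exact sq_sum_le_card_mul_sum_sq
  rw [hexp]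
  have hsum : (Fintype.card ι : ℝ) ^ 2 * ∑ f, ∑ g, (if μ f = μ g then (1 : ℝ) else 0) ≤
      ∑ f, ∑ g, (∑ i, P i f * P i g) ^ 2 := by
    simp only [Finset.mul_sum, mul_ite, mul_one, mul_zero]
    exact Finset.sum_le_sum fun f _ => Finset.sum_le_sum fun g _ => hlow f g
  calc _ ≤ (Fintype.card ι : ℝ) ^ 2 * ((Fintype.card X).multichoose p *
        ∑ f, ∑ g, if μ f = μ g then (1 : ℝ) else 0) := by gcongr
    _ = (Fintype.card X).multichoose p * ((Fintype.card ι : ℝ) ^ 2 *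
        ∑ f, ∑ g, if μ f = μ g then (1 : ℝ) else 0) := by ring
    _ ≤ _ := by gcongr

/-- In the moment sum, diagonal terms are `K^(2p)` and the others at most `(δK)^(2p)`; compare with
the Welch bound. -/
theorem card_le_multichoose_mul {ι X : Type} [Fintype ι] [Fintype X] [Nonempty X]
    (w : ι → X → ℝ) (hw : ∀ i x, w i x = 1 ∨ w i x = -1) (δ : ℝ)
    (hoff : ∀ i j, i ≠ j → |∑ x, w i x * w j x| ≤ δ * Fintype.card X) (p : ℕ) :
    (Fintype.card ι : ℝ) ≤ (Fintype.card X).multichoose p *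
      (1 + Fintype.card ι * (δ ^ 2) ^ p) := by
  classical
  have hK : (0 : ℝ) < Fintype.card X := by exact_mod_cast Fintype.card_pos
  rcases isEmpty_or_nonempty ι with hι | hι
  · simp
  have hn : (0 : ℝ) < Fintype.card ι := by exact_mod_cast Fintype.card_pos
  set K : ℝ := (Fintype.card X : ℝ) with hKdef
  set n : ℝ := (Fintype.card ι : ℝ) with hndef
  have hpt : ∀ i j, (∑ x, w i x * w j x) ^ (2 * p) ≤
      (if i = j then (K ^ p) ^ 2 else 0) + (δ ^ 2) ^ p * (K ^ p) ^ 2 := by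
    intro i j
    split_ifs with h
    · subst h
      have h1 : ∀ x, w i x * w i x = 1 := fun x => by rcases hw i x with h | h <;> simp [h]
      have h2 : 0 ≤ (δ ^ 2) ^ p * (K ^ p) ^ 2 := by positivity
      simp only [h1, Finset.sum_const, Finset.card_univ, nsmul_eq_mul, mul_one, ← hKdef]
      rw [show K ^ (2 * p) = (K ^ p) ^ 2 by rw [← pow_mul, mul_comm]]
      linarith
    · rw [zero_add, ← pow_mul, ← pow_mul, mul_comm p 2, ← mul_pow,
        ← Even.pow_abs (by simp : Even (2 * p))]
      exact pow_le_pow_left₀ (abs_nonneg _) (hoff i j h) _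
  have hS : ∑ i, ∑ j, (∑ x, w i x * w j x) ^ (2 * p) ≤
      n * (K ^ p) ^ 2 + n ^ 2 * ((δ ^ 2) ^ p * (K ^ p) ^ 2) := by
    refine (Finset.sum_le_sum fun i _ => Finset.sum_le_sum fun j _ => hpt i j).trans (le_of_eq ?_)
    simp only [Finset.sum_add_distrib, Finset.sum_ite_eq, Finset.mem_univ, if_true,
      Finset.sum_const, Finset.card_univ, nsmul_eq_mul, ← hndef]
    ring
  have hW := card_sq_mul_pow_le_choose_mul_sum w hw p
  have hM : (0 : ℝ) ≤ (Fintype.card X).multichoose p := by positivity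
  have h3 := hW.trans (mul_le_mul_of_nonneg_left hS hM)
  have hKp : 0 < n * (K ^ p) ^ 2 := by positivity
  refine le_of_mul_le_mul_left ?_ hKp
  rw [← hKdef, ← hndef] at h3
  linarith

theorem multichoose_le_pow {K p : ℕ} (hp : 0 < p) (hpK : p ≤ K) :
    (K.multichoose p : ℝ) ≤ (6 * K / p) ^ p := by
  have hp' : (0 : ℝ) < p := by exact_mod_cast hp
  rw [Nat.multichoose_eq]
  have h1 : ((K + p - 1).choose p : ℝ) ≤ ((K + p - 1 : ℕ) : ℝ) ^ p / (p.factorial : ℝ) :=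
    Nat.choose_le_pow_div p (K + p - 1)
  have h2 : ((K + p - 1 : ℕ) : ℝ) ≤ 2 * K := by
    have : K + p - 1 ≤ 2 * K := by omega
    exact_mod_cast this
  have h3 : (p : ℝ) ^ p ≤ 3 ^ p * p.factorial := by
    have h4 := Real.pow_div_factorial_le_exp (p : ℝ) hp'.le p
    rw [div_le_iff₀ (by positivity)] at h4
    refine h4.trans (mul_le_mul_of_nonneg_right ?_ (by positivity))
    rw [← mul_one (p : ℝ), Real.exp_nat_mul]
    exact pow_le_pow_left₀ (Real.exp_pos _).le (by linarith [Real.exp_one_lt_d9]) _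
  refine h1.trans ?_
  rw [div_pow, div_le_div_iff₀ (by positivity) (by positivity)]
  calc ((K + p - 1 : ℕ) : ℝ) ^ p * (p : ℝ) ^ p ≤ (2 * K) ^ p * (3 ^ p * p.factorial) := by gcongr
    _ = (6 * K) ^ p * p.factorial := by
      rw [← mul_assoc, ← mul_pow]; ring

/-- Alon's bound on the number of sign vectors with small pairwise inner products. -/
theorem card_le_two_mul_pow {ι X : Type} [Fintype ι] [Fintype X] [Nonempty X]
    (w : ι → X → ℝ) (hw : ∀ i x, w i x = 1 ∨ w i x = -1) (δ : ℝ)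
    (hoff : ∀ i j, i ≠ j → |∑ x, w i x * w j x| ≤ δ * Fintype.card X) {p : ℕ} (hp : 0 < p)
    (hpK : p ≤ Fintype.card X) (hδ : 12 * Fintype.card X * δ ^ 2 ≤ p) :
    (Fintype.card ι : ℝ) ≤ 2 * (6 * Fintype.card X / p) ^ p := by
  have h1 := card_le_multichoose_mul w hw δ hoff p
  have h2 := multichoose_le_pow hp hpK
  have hp' : (0 : ℝ) < p := by exact_mod_cast hp
  set K : ℝ := (Fintype.card X : ℝ)
  set n : ℝ := (Fintype.card ι : ℝ)
  have hn : 0 ≤ n := by positivity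
  have hK : 0 ≤ K := by positivity
  -- This makes the term containing `n` on the right at most `n/2`, so it can be absorbed.
  have h3 : (6 * K / p) ^ p * (δ ^ 2) ^ p ≤ 1 / 2 := by
    rw [← mul_pow]
    have h4 : 6 * K / p * δ ^ 2 ≤ 1 / 2 := by
      rw [div_mul_eq_mul_div, div_le_iff₀ hp']
      linarith
    have h5 : 0 ≤ 6 * K / p * δ ^ 2 := by positivity
    calc _ ≤ (6 * K / p * δ ^ 2) ^ 1 := pow_le_pow_of_le_one h5 (by linarith) hp
      _ ≤ 1 / 2 := by rwa [pow_one]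
  have h6 : n ≤ (6 * K / p) ^ p * (1 + n * (δ ^ 2) ^ p) :=
    h1.trans (mul_le_mul_of_nonneg_right h2 (by positivity))
  nlinarith

end Moments

/-! ### Good seeds and products of their outputs. -/

section GoodSeeds

/-- The seeds whose output on `S` is predicted by the outputs on any `t` other seeds with
advantage at most `δ`. -/
def IsGoodSeed {n d : ℕ} (ext : Bits n → Bits d → Bool) (S : Finset (Bits n)) (t : ℕ) (δ : ℝ)
    (s : Bits d) : Prop :=
  ∀ B : Fin t → Bits d, (∀ i, B i ≠ s) → ∀ f : (Fin t → Bool) → ℝ, (∀ w, f w = 1 ∨ f w = -1) →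
    ∑ x ∈ S, sgn (ext x s) * f (fun i => ext x (B i)) ≤ δ * S.card

theorem exists_ne_seed {d : ℕ} (hd : 1 ≤ d) (s : Bits d) : ∃ s', s' ≠ s := by
  have : Nonempty (Fin d) := ⟨⟨0, hd⟩⟩
  exact exists_ne s

theorem IsNonMalleableExtractor.sum_abs_le {n d k t : ℕ} {ε : ℝ}
    {ext : Bits n → Bits d → Bool} (h : IsNonMalleableExtractor k ε t ext) (hd : 1 ≤ d)
    (S : Finset (Bits n)) (hS : S.card = 2 ^ k) :
    ∑ s, |∑ x ∈ S, sgn (ext x s)| ≤ 2 * ε * 2 ^ k * 2 ^ d := by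
  classical
  choose A hA using exists_ne_seed hd
  refine le_trans (le_of_eq ?_) (h.sum_predictor_le S hS (fun s _ => A s) (fun s _ => hA s)
    (fun s _ => if 0 ≤ ∑ x ∈ S, sgn (ext x s) then 1 else -1) ?_)
  · refine Finset.sum_congr rfl fun s _ => ?_
    split_ifs with h0
    · simp [abs_of_nonneg h0]
    · rw [← Finset.sum_mul, abs_of_neg (not_le.1 h0)]; ring
  · intro s w
    split_ifs <;> simp

open Classical in
theorem IsNonMalleableExtractor.two_pow_le_card_good {n d k t : ℕ} {ε : ℝ} (hε : 0 < ε)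
    {ext : Bits n → Bits d → Bool} (h : IsNonMalleableExtractor k ε t ext) (hd : 1 ≤ d)
    (S : Finset (Bits n)) (hS : S.card = 2 ^ k) :
    (2 : ℝ) ^ d / 2 ≤ (Finset.univ.filter (IsGoodSeed ext S t (4 * ε))).card := by
  have hK : (0 : ℝ) < 2 ^ k := by positivity
  -- Tampering and predictor may depend on the seed, so the attacks on all bad seeds combine into
  -- one. On good seeds a constant guess of the right sign does no harm, and Markov's inequality
  -- finishes.
  have hex : ∀ s, ∃ (B : Fin t → Bits d) (f : (Fin t → Bool) → ℝ), (∀ i, B i ≠ s) ∧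
      (∀ w, f w = 1 ∨ f w = -1) ∧
      (if IsGoodSeed ext S t (4 * ε) s then (0 : ℝ) else 4 * ε * 2 ^ k) ≤
        ∑ x ∈ S, sgn (ext x s) * f (fun i => ext x (B i)) := by
    intro s
    split_ifs with hg
    · obtain ⟨s', hs'⟩ := exists_ne_seed hd s
      by_cases h0 : 0 ≤ ∑ x ∈ S, sgn (ext x s)
      · exact ⟨fun _ => s', fun _ => 1, fun _ => hs', by simp, by simpa using h0⟩
      · refine ⟨fun _ => s', fun _ => -1, fun _ => hs', by simp, ?_⟩
        simp only [mul_neg, mul_one, Finset.sum_neg_distrib]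
        linarith
    · unfold IsGoodSeed at hg
      push Not at hg
      obtain ⟨B, hB, f, hf, hlt⟩ := hg
      rw [hS] at hlt
      push_cast at hlt
      exact ⟨B, f, hB, hf, hlt.le⟩
  choose A f hA hf hle using hex
  have h1 := (Finset.sum_le_sum fun s (_ : s ∈ Finset.univ) => hle s).trans
    (h.sum_predictor_le S hS A hA f hf)
  rw [Finset.sum_ite, Finset.sum_const_zero, zero_add, Finset.sum_const, nsmul_eq_mul] at h1
  have h2 : ((Finset.univ.filter (IsGoodSeed ext S t (4 * ε))).card : ℝ) +
      (Finset.univ.filter fun s => ¬ IsGoodSeed ext S t (4 * ε) s).card = 2 ^ d := by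
    have := Finset.card_filter_add_card_filter_not (s := (Finset.univ : Finset (Bits d)))
      (IsGoodSeed ext S t (4 * ε))
    simp only [Finset.card_univ, Fintype.card_pi, Fintype.card_bool, Finset.prod_const,
      Fintype.card_fin] at this
    exact_mod_cast this
  have h3 : 0 < 4 * ε * 2 ^ k := by positivity
  have h4 : (4 * ε * 2 ^ k) *
      ((Finset.univ.filter fun s => ¬ IsGoodSeed ext S t (4 * ε) s).card : ℝ) ≤
      (4 * ε * 2 ^ k) * (2 ^ d / 2) := by linarith
  have := le_of_mul_le_mul_left h4 h3
  linarith

theorem prod_eq_one_or_neg_one {ι : Type} (R : Finset ι) (a : ι → ℝ)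
    (ha : ∀ i ∈ R, a i = 1 ∨ a i = -1) : ∏ i ∈ R, a i = 1 ∨ ∏ i ∈ R, a i = -1 := by
  refine Finset.prod_induction a (fun y => y = 1 ∨ y = -1) ?_ (Or.inl rfl) ha
  rintro _ _ (rfl | rfl) (rfl | rfl) <;> simp

/-- Outputs on at most `t + 1` distinct good seeds have nearly unbiased product. -/
theorem abs_sum_prod_good_le {n d t : ℕ} (hd : 1 ≤ d) {ext : Bits n → Bits d → Bool}
    {S : Finset (Bits n)} {δ : ℝ} (R : Finset (Bits d)) (hR : ∀ s ∈ R, IsGoodSeed ext S t δ s)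
    (hne : R.Nonempty) (hcard : R.card ≤ t + 1) :
    |∑ x ∈ S, ∏ s ∈ R, sgn (ext x s)| ≤ δ * S.card := by
  classical
  obtain ⟨s₀, hs₀⟩ := hne
  obtain ⟨s', hs'⟩ := exists_ne_seed hd s₀
  have hc : Fintype.card (R.erase s₀) ≤ Fintype.card (Fin t) := by
    rw [Fintype.card_coe, Finset.card_erase_of_mem hs₀, Fintype.card_fin]; omega
  obtain ⟨e⟩ := Function.Embedding.nonempty_of_card_le hc
  -- Unused tampering slots are filled with `s'`, which the predictor ignores.
  let B : Fin t → Bits d := Function.extend e Subtype.val (fun _ => s')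
  have hBe : ∀ r, B (e r) = r := fun r => e.injective.extend_apply _ _ r
  have hB : ∀ i, B i ≠ s₀ := by
    intro i
    by_cases hi : ∃ r, e r = i
    · obtain ⟨r, rfl⟩ := hi
      rw [hBe]
      exact Finset.ne_of_mem_erase r.2
    · simpa only [B, Function.extend_apply' _ _ _ hi] using hs'
  let f : (Fin t → Bool) → ℝ := fun w => ∏ r, sgn (w (e r))
  have hf : ∀ w, f w = 1 ∨ f w = -1 := fun w =>
    prod_eq_one_or_neg_one _ _ fun r _ => sgn_eq_one_or _
  have hprod : ∀ x, ∏ s ∈ R, sgn (ext x s) = sgn (ext x s₀) * f (fun i => ext x (B i)) := by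
    intro x
    rw [← Finset.mul_prod_erase R _ hs₀]
    simp only [f, hBe]
    rw [Finset.prod_coe_sort (R.erase s₀) fun s => sgn (ext x s)]
  simp only [hprod]
  refine abs_le'.2 ⟨hR s₀ hs₀ B hB f hf, ?_⟩
  have := hR s₀ hs₀ B hB (fun w => - f w) (fun w => by
    rcases hf w with h | h <;> simp [h])
  simpa only [mul_neg, Finset.sum_neg_distrib] using this

/-- Common factors square to `1`, leaving the nonempty symmetric difference, of size at most `2r ≤ t
+ 1`. -/
theorem abs_sum_prod_mul_prod_le {n d t r : ℕ} (hd : 1 ≤ d) {ext : Bits n → Bits d → Bool}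
    {S : Finset (Bits n)} {δ : ℝ} {T T' : Finset (Bits d)}
    (hT : ∀ s ∈ T, IsGoodSeed ext S t δ s) (hT' : ∀ s ∈ T', IsGoodSeed ext S t δ s)
    (hne : T ≠ T') (hc : T.card = r) (hc' : T'.card = r) (hr : 2 * r ≤ t + 1) :
    |∑ x ∈ S, (∏ s ∈ T, sgn (ext x s)) * ∏ s ∈ T', sgn (ext x s)| ≤ δ * S.card := by
  classical
  have hdisj : Disjoint (T \ T') (T' \ T) := disjoint_sdiff_sdiff
  have h1 : ∀ x, (∏ s ∈ T, sgn (ext x s)) * ∏ s ∈ T', sgn (ext x s) =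
      ∏ s ∈ (T \ T') ∪ (T' \ T), sgn (ext x s) := by
    intro x
    rw [Finset.prod_union hdisj, ← Finset.prod_inter_mul_prod_sdiff T T',
      ← Finset.prod_inter_mul_prod_sdiff T' T, Finset.inter_comm T' T]
    rcases prod_eq_one_or_neg_one (T ∩ T') (fun s => sgn (ext x s))
      (fun s _ => sgn_eq_one_or _) with h | h <;> rw [h] <;> ring
  simp only [h1]
  refine abs_sum_prod_good_le (t := t) hd _ ?_ ?_ ?_
  · intro s hs
    rcases Finset.mem_union.1 hs with h | h
    · exact hT s (Finset.mem_sdiff.1 h).1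
    · exact hT' s (Finset.mem_sdiff.1 h).1
  · rw [Finset.nonempty_iff_ne_empty]
    intro h0
    rw [Finset.union_eq_empty, Finset.sdiff_eq_empty_iff_subset,
      Finset.sdiff_eq_empty_iff_subset] at h0
    exact hne (h0.1.antisymm h0.2)
  · have h2 := Finset.card_union_le (T \ T') (T' \ T)
    have h3 := Finset.card_le_card (Finset.sdiff_subset (s := T) (t := T'))
    have h4 := Finset.card_le_card (Finset.sdiff_subset (s := T') (t := T))
    omega

/-- The products over `r`-subsets of good seeds form a family of nearly orthogonal sign vectors. -/
theorem exists_near_orthogonal {n d t r : ℕ} (hd : 1 ≤ d) {ext : Bits n → Bits d → Bool}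
    {S : Finset (Bits n)} {δ : ℝ} (G : Finset (Bits d)) (hG : ∀ s ∈ G, IsGoodSeed ext S t δ s)
    (hr : 2 * r ≤ t + 1) :
    ∃ w : G.powersetCard r → S → ℝ, (∀ i x, w i x = 1 ∨ w i x = -1) ∧
      ∀ i j, i ≠ j → |∑ x, w i x * w j x| ≤ δ * Fintype.card S := by
  refine ⟨fun T x => ∏ s ∈ T.1, sgn (ext x s), fun T x =>
    prod_eq_one_or_neg_one _ _ fun s _ => sgn_eq_one_or _, ?_⟩
  rintro ⟨T, hT⟩ ⟨T', hT'⟩ hne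
  rw [Finset.mem_powersetCard] at hT hT'
  rw [Fintype.card_coe, Finset.sum_coe_sort S
    fun x => (∏ s ∈ T, sgn (ext x s)) * ∏ s ∈ T', sgn (ext x s)]
  exact abs_sum_prod_mul_prod_le hd (fun s hs => hG s (hT.1 hs)) (fun s hs => hG s (hT'.1 hs))
    (fun h => hne (Subtype.ext h)) hT.2 hT'.2 hr

theorem choose_card_le_two_mul_pow {n d t r : ℕ} (hd : 1 ≤ d) {ext : Bits n → Bits d → Bool}
    {S : Finset (Bits n)} (hS : S.Nonempty) {δ : ℝ} (G : Finset (Bits d))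
    (hG : ∀ s ∈ G, IsGoodSeed ext S t δ s) (hr : 2 * r ≤ t + 1) {p : ℕ} (hp : 0 < p)
    (hpK : p ≤ S.card) (hδ : 12 * S.card * δ ^ 2 ≤ p) :
    (G.card.choose r : ℝ) ≤ 2 * (6 * S.card / p) ^ p := by
  have := hS.coe_sort
  obtain ⟨w, hw, hoff⟩ := exists_near_orthogonal (r := r) hd G hG hr
  have h := card_le_two_mul_pow w hw δ hoff hp (by rwa [Fintype.card_coe])
    (by rwa [Fintype.card_coe])
  rwa [Fintype.card_coe, Fintype.card_coe, Finset.card_powersetCard] at h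

theorem card_good_le {n d t : ℕ} (hd : 1 ≤ d) (ht : 1 ≤ t) {ext : Bits n → Bits d → Bool}
    {S : Finset (Bits n)} (hS : S.Nonempty) {δ : ℝ} (G : Finset (Bits d))
    (hG : ∀ s ∈ G, IsGoodSeed ext S t δ s) :
    (G.card : ℝ) ≤ S.card * (1 + G.card * δ ^ 2) := by
  have := hS.coe_sort
  obtain ⟨w, hw, hoff⟩ := exists_near_orthogonal (r := 1) hd G hG (by omega)
  have h := card_le_multichoose_mul w hw δ hoff 1
  rwa [Fintype.card_coe, Fintype.card_coe, Finset.card_powersetCard, Nat.choose_one_right,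
    Nat.multichoose_one_right, pow_one] at h

end GoodSeeds

/-! ### Lower bound on the source entropy. -/

section SourceEntropy

theorem pow_le_choose_of_mul_le {g r : ℕ} {a : ℝ} (ha : 0 ≤ a) (h : (r : ℝ) * a + r ≤ g) :
    a ^ r ≤ g.choose r := by
  rcases Nat.eq_zero_or_pos r with rfl | hr
  · simp
  have hr' : (0 : ℝ) < r := by exact_mod_cast hr
  have hrg : r ≤ g := by
    have : (r : ℝ) ≤ g := by nlinarith [mul_nonneg hr'.le ha]
    exact_mod_cast this
  refine le_trans ?_ (Nat.pow_le_choose r g)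
  have h3 : (r.factorial : ℝ) ≤ r ^ r := by exact_mod_cast Nat.factorial_le_pow r
  have h4 : (r : ℝ) * a ≤ ((g + 1 - r : ℕ) : ℝ) := by
    rw [Nat.cast_sub (by omega)]; push_cast; linarith
  rw [le_div_iff₀ (by positivity)]
  calc a ^ r * r.factorial ≤ a ^ r * r ^ r := by gcongr
    _ = (r * a) ^ r := by rw [mul_pow]; ring
    _ ≤ _ := by gcongr

/-- With `a = 2^(d/4)`, the subset size is at most `t ≤ a²` while `g ≥ a⁴/2`; `d ≥ 8` gives `a ≥ 4`,
hence room for `a²(a+1) ≤ a⁴/2`. -/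
theorem rpow_quarter_le_choose {d t g : ℕ} (hd : 8 ≤ d) (ht : (t : ℝ) ≤ (2 : ℝ) ^ ((d : ℝ) / 2))
    (ht1 : 1 ≤ t) (hg : (2 : ℝ) ^ d / 2 ≤ g) :
    ((2 : ℝ) ^ ((d : ℝ) / 4)) ^ ((t + 1) / 2) ≤ g.choose ((t + 1) / 2) := by
  set a : ℝ := (2 : ℝ) ^ ((d : ℝ) / 4) with ha
  have ha4 : 4 ≤ a := by
    have h8 : (8 : ℝ) ≤ d := by exact_mod_cast hd
    calc (4 : ℝ) = (2 : ℝ) ^ (2 : ℝ) := by norm_num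
      _ ≤ a := Real.rpow_le_rpow_of_exponent_le (by norm_num) (by linarith)
  have h2 : (2 : ℝ) ^ ((d : ℝ) / 2) = a ^ 2 := by
    rw [ha, ← Real.rpow_natCast, ← Real.rpow_mul (by norm_num)]
    congr 1; push_cast; ring
  have h4 : (2 : ℝ) ^ d = a ^ 4 := by
    rw [ha, ← Real.rpow_natCast, ← Real.rpow_natCast, ← Real.rpow_mul (by norm_num)]
    congr 1; push_cast; ring
  apply pow_le_choose_of_mul_le (by linarith)
  have hr : (((t + 1) / 2 : ℕ) : ℝ) ≤ t := by
    have : (t + 1) / 2 ≤ t := by omega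
    exact_mod_cast this
  have h5 : (((t + 1) / 2 : ℕ) : ℝ) ≤ a ^ 2 := by rw [← h2]; exact hr.trans ht
  have h6 : a ^ 2 * (a + 1) ≤ a ^ 4 / 2 := by
    have : 2 * (a + 1) ≤ a ^ 2 := by nlinarith
    nlinarith [sq_nonneg a]
  calc (((t + 1) / 2 : ℕ) : ℝ) * a + ((t + 1) / 2 : ℕ) = ((t + 1) / 2 : ℕ) * (a + 1) := by ring
    _ ≤ a ^ 2 * (a + 1) := by gcongr
    _ ≤ g := by rw [h4] at hg; linarith

theorem mul_le_of_nonMalleable {n d k t : ℕ} {ε : ℝ} (hε : 0 < ε) (hε' : ε < 1 / 10000)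
    {ext : Bits n → Bits d → Bool} (h : IsNonMalleableExtractor k ε t ext) (hkn : k < n)
    (hd : 1 ≤ d) (ht : 1 ≤ t) (htd : (t : ℝ) ≤ (2 : ℝ) ^ ((d : ℝ) / 2))
    (hD : 1 ≤ 93312 * ε ^ 2 * 2 ^ d) :
    (t : ℝ) * d ≤ 2989312 * 2 ^ k * ε ^ 2 * Real.logb 2 (1 / ε) := by
  classical
  have hcardX : 2 ^ k ≤ (Finset.univ : Finset (Bits n)).card := by
    simpa using Nat.pow_le_pow_right (by norm_num : 0 < 2) hkn.le
  obtain ⟨S, -, hS⟩ := Finset.exists_subset_card_eq hcardX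
  have hSne : S.Nonempty := by
    rw [← Finset.card_pos, hS]; positivity
  set G := Finset.univ.filter (IsGoodSeed ext S t (4 * ε)) with hGdef
  have hG : ∀ s ∈ G, IsGoodSeed ext S t (4 * ε) s := fun s hs => (Finset.mem_filter.1 hs).2
  have hGc : (2 : ℝ) ^ d / 2 ≤ G.card := h.two_pow_le_card_good hε hd S hS
  have hε2 : ε ^ 2 < 1 / 10 ^ 8 := by nlinarith
  have hε20 : 0 < ε ^ 2 := by positivity
  have hd8 : 8 ≤ d := by
    by_contra! hlt
    have : (2 : ℝ) ^ d ≤ 2 ^ 7 := pow_le_pow_right₀ (by norm_num) (by omega)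
    nlinarith
  have hSK : (S.card : ℝ) = 2 ^ k := by rw [hS]; norm_num
  set K : ℝ := 2 ^ k with hKdef
  have hK0 : 0 < K := by positivity
  set z := K * ε ^ 2 with hz
  have hz0 : 0 < z := by positivity
  -- Single good outputs with `p = 1` give `|G|(1 - 16z) ≤ K`, and `hD` bounds `|G|` below. So
  -- rounding up in `p` costs only a constant factor.
  have hKlow : 1 ≤ 186640 * z := by
    have h1 := card_good_le hd ht hSne G hG
    rw [hSK] at h1
    by_contra! hlt
    have h2 : (G.card : ℝ) * (1 - 16 * z) ≤ K := by rw [hz]; linarith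
    have h3 : 0 ≤ 1 - 16 * z := by linarith
    have h4 : (2 : ℝ) ^ d / 2 * (1 - 16 * z) ≤ K :=
      (mul_le_mul_of_nonneg_right hGc h3).trans h2
    have h5 := mul_le_mul_of_nonneg_left h4 hε20.le
    have h6 : ε ^ 2 * 2 ^ d * (1 - 16 * z) ≤ 2 * z := by rw [hz] at *; linarith
    have h7 : 1 * (1 - 16 * z) ≤ 93312 * ε ^ 2 * 2 ^ d * (1 - 16 * z) :=
      mul_le_mul_of_nonneg_right hD h3
    linarith
  -- `192 = 12 * 4²`: Alon's condition `12Kδ² ≤ p` with `δ = 4ε`.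
  set p := ⌈192 * z⌉₊ with hp
  have hp0 : 0 < p := Nat.ceil_pos.2 (by positivity)
  have hp1 : 192 * z ≤ p := Nat.le_ceil _
  have hp2 : (p : ℝ) ≤ 186832 * z := by
    have := Nat.ceil_lt_add_one (show 0 ≤ 192 * z by positivity)
    linarith
  have hpK : p ≤ S.card := by
    have : (p : ℝ) ≤ S.card := by
      rw [hSK]; refine hp2.trans ?_; rw [hz]; nlinarith
    exact_mod_cast this
  have hup := choose_card_le_two_mul_pow hd hSne G hG (r := (t + 1) / 2) (by omega) hp0 hpK
    (by rw [hSK]; refine le_trans (le_of_eq ?_) hp1; rw [hz]; ring)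
  have hlow := rpow_quarter_le_choose hd8 htd ht hGc
  have hp0' : (0 : ℝ) < p := by exact_mod_cast hp0
  have hup2 : 2 * (6 * (S.card : ℝ) / p) ^ p ≤ ((1 / ε) ^ 2) ^ p := by
    have h1 : 6 * (S.card : ℝ) / p ≤ (1 / ε) ^ 2 / 2 := by
      rw [hSK, div_le_iff₀ hp0', one_div, inv_pow]
      have h2 : (ε ^ 2)⁻¹ / 2 * (192 * z) ≤ (ε ^ 2)⁻¹ / 2 * p := by gcongr
      have h3 : (ε ^ 2)⁻¹ / 2 * (192 * z) = 96 * K := by rw [hz]; field_simp; norm_num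
      linarith
    have h2 : (2 : ℝ) ^ 1 ≤ 2 ^ p := pow_le_pow_right₀ (by norm_num) hp0
    calc 2 * (6 * (S.card : ℝ) / p) ^ p ≤ 2 ^ p * ((1 / ε) ^ 2 / 2) ^ p := by
          gcongr; linarith
      _ = ((1 / ε) ^ 2) ^ p := by rw [← mul_pow]; congr 1; ring
  have hfin := (hlow.trans hup).trans hup2
  have hlogs := Real.logb_le_logb_of_le (b := 2) (by norm_num) (by positivity) hfin
  rw [Real.logb_pow, Real.logb_pow, Real.logb_pow, Real.logb_rpow (by norm_num) (by norm_num)]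
    at hlogs
  have hL : 0 ≤ Real.logb 2 (1 / ε) :=
    Real.logb_nonneg (by norm_num) (by rw [le_div_iff₀ hε]; linarith)
  have hr : (t : ℝ) / 2 ≤ ((t + 1) / 2 : ℕ) := by
    have : t ≤ 2 * ((t + 1) / 2) := by omega
    have : (t : ℝ) ≤ 2 * ((t + 1) / 2 : ℕ) := by exact_mod_cast this
    linarith
  have h1 : (t : ℝ) / 2 * (d / 4) ≤ ((t + 1) / 2 : ℕ) * ((d : ℝ) / 4) := by gcongr
  have h2 : (p : ℝ) * Real.logb 2 (1 / ε) ≤ 186832 * z * Real.logb 2 (1 / ε) := by gcongr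
  push_cast at hlogs h1
  have h3 : 2989312 * K * ε ^ 2 * Real.logb 2 (1 / ε) =
    16 * (186832 * z * Real.logb 2 (1 / ε)) := by rw [hz]; ring
  rw [h3]
  linarith

end SourceEntropy

/-! ### Passage to logarithms. -/

section Logarithms

theorem seed_length_bound {n k d : ℕ} {ε : ℝ} (hε : 0 < ε) (hkn : k < n)
    (hD : (n : ℝ) - k ≤ 93312 * ε ^ 2 * 2 ^ d) :
    (d : ℝ) > Real.logb 2 ((n : ℝ) - k) + 2 * Real.logb 2 (1 / ε) - 22 := by
  have hnk : (0 : ℝ) < (n : ℝ) - k := by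
    have : (k : ℝ) < n := by exact_mod_cast hkn
    linarith
  have h1 : ((n : ℝ) - k) * (1 / ε) ^ 2 < (2 : ℝ) ^ (d + 22) := by
    rw [one_div, inv_pow, ← div_eq_mul_inv, div_lt_iff₀ (by positivity), pow_add]
    have : 0 < ε ^ 2 * 2 ^ d := by positivity
    linarith
  have h2 := Real.logb_lt_logb (b := 2) (by norm_num) (by positivity) h1
  rw [Real.logb_mul hnk.ne' (by positivity), Real.logb_pow, Real.logb_pow,
    Real.logb_self_eq_one (by norm_num)] at h2
  push_cast at h2
  linarith

theorem source_entropy_bound {k d t : ℕ} {ε : ℝ} (hε : 0 < ε) (hε' : ε < 1) (hd : 1 ≤ d)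
    (ht : 1 ≤ t) (h : (t : ℝ) * d ≤ 2989312 * 2 ^ k * ε ^ 2 * Real.logb 2 (1 / ε)) :
    (k : ℝ) ≥ Real.logb 2 (d : ℝ) + 2 * Real.logb 2 (1 / ε)
      - Real.logb 2 (Real.logb 2 (1 / ε)) + Real.logb 2 (t : ℝ) - 22 := by
  have hL : 0 < Real.logb 2 (1 / ε) :=
    Real.logb_pos (by norm_num) (by rwa [lt_div_iff₀ hε, one_mul])
  set L := Real.logb 2 (1 / ε) with hLdef
  have hd0 : (0 : ℝ) < d := by exact_mod_cast hd
  have ht0 : (0 : ℝ) < t := by exact_mod_cast ht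
  have h1 : (t : ℝ) * d * (1 / ε) ^ 2 ≤ (2 : ℝ) ^ (k + 22) * L := by
    rw [one_div, inv_pow, ← div_eq_mul_inv, div_le_iff₀ (by positivity), pow_add]
    have : 0 < 2 ^ k * ε ^ 2 * L := by positivity
    linarith
  have h2 := Real.logb_le_logb_of_le (b := 2) (by norm_num) (by positivity) h1
  rw [Real.logb_mul (by positivity) (by positivity), Real.logb_mul ht0.ne' hd0.ne',
    Real.logb_mul (by positivity) hL.ne', Real.logb_pow, Real.logb_pow,
    Real.logb_self_eq_one (by norm_num), ← hLdef] at h2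
  push_cast at h2
  linarith

theorem logb_two_le_self {x : ℝ} (hx : 0 < x) : Real.logb 2 x ≤ x := by
  have h1 := Real.log_le_sub_one_of_pos (half_pos hx)
  rw [Real.log_div hx.ne' (by norm_num)] at h1
  have h2 := Real.log_two_lt_d9
  have h3 := Real.log_two_gt_d9
  rw [Real.logb, div_le_iff₀ (by linarith)]
  nlinarith

theorem loglog_bound {n k d t : ℕ} {ε : ℝ} (hε : 0 < ε) (hε' : ε < 1 / 2 ^ 24)
    (ht : 1 ≤ t) (hn : 2 ≤ n)
    (h1 : (d : ℝ) > Real.logb 2 ((n : ℝ) - k) + 2 * Real.logb 2 (1 / ε) - 22)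
    (h2 : (k : ℝ) ≥ Real.logb 2 (d : ℝ) + 2 * Real.logb 2 (1 / ε)
      - Real.logb 2 (Real.logb 2 (1 / ε)) + Real.logb 2 (t : ℝ) - 22) :
    (k : ℝ) ≥ 1 / 2 * Real.logb 2 (Real.logb 2 (n : ℝ)) := by
  have hL : 24 ≤ Real.logb 2 (1 / ε) := by
    rw [Real.le_logb_iff_rpow_le (by norm_num) (by positivity), le_div_iff₀ hε]
    norm_num at hε' ⊢
    linarith
  have hn' : (2 : ℝ) ≤ n := by exact_mod_cast hn
  have hlogn : 1 ≤ Real.logb 2 (n : ℝ) := by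
    rw [Real.le_logb_iff_rpow_le (by norm_num) (by linarith)]; simpa using hn'
  have hll : 0 ≤ Real.logb 2 (Real.logb 2 (n : ℝ)) := Real.logb_nonneg (by norm_num) hlogn
  -- If `k ≥ n/2` the claim is trivial; otherwise `n - k > n/2` gives `d ≥ log n`, and `log(1/ε) ≥
  -- 24` outweighs the constants.
  rcases le_or_gt ((n : ℝ) / 2) k with hk | hk
  · have h3 := logb_two_le_self (x := n) (by linarith)
    have h4 := logb_two_le_self (x := Real.logb 2 n) (by linarith)
    linarith
  · have h3 : Real.logb 2 ((n : ℝ) / 2) ≤ Real.logb 2 ((n : ℝ) - k) :=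
      Real.logb_le_logb_of_le (by norm_num) (by linarith) (by linarith)
    rw [Real.logb_div (by linarith) (by norm_num), Real.logb_self_eq_one (by norm_num)] at h3
    have h4 : Real.logb 2 (n : ℝ) ≤ d := by linarith
    have h5 := Real.logb_le_logb_of_le (b := 2) (by norm_num) (by linarith) h4
    have h6 := logb_two_le_self (x := Real.logb 2 (1 / ε)) (by linarith)
    have h7 : 0 ≤ Real.logb 2 (t : ℝ) :=
      Real.logb_nonneg (by norm_num) (by exact_mod_cast ht)
    linarith

end Logarithms

end NMExt

theorem theorem1 :
    ∃ c₀ C c : ℝ, ∃ n₀ : ℕ, 0 < c₀ ∧ c₀ < 1 ∧ 0 < c ∧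
      ∀ (n k d t : ℕ) (ε : ℝ) (nmExt : NMExt.Bits n → NMExt.Bits d → Bool),
        k < n → 1 ≤ d → 1 ≤ t → (t : ℝ) ≤ (2 : ℝ) ^ ((d : ℝ) / 2) → 0 < ε → ε < c₀ →
        NMExt.IsNonMalleableExtractor k ε t nmExt →
          (d : ℝ) > Real.logb 2 ((n : ℝ) - (k : ℝ)) + 2 * Real.logb 2 (1 / ε) - C ∧
          (k : ℝ) ≥ Real.logb 2 (d : ℝ) + 2 * Real.logb 2 (1 / ε)
            - Real.logb 2 (Real.logb 2 (1 / ε)) + Real.logb 2 (t : ℝ) - C ∧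
          (n₀ ≤ n → (k : ℝ) ≥ c * Real.logb 2 (Real.logb 2 (n : ℝ))) := by
  -- Both `93312` and `2989312` are below `2^22`; `n₀ = 2` keeps `log log n` nonnegative.
  refine ⟨1 / 2 ^ 24, 22, 1 / 2, 2, by norm_num, by norm_num, by norm_num, ?_⟩
  intro n k d t ε nmExt hkn hd ht htd hε hε' h
  have hεs : ε < 1 / 10000 := hε'.trans (by norm_num)
  have hD := NMExt.sub_le_of_balanced (fun x s => NMExt.sgn (nmExt x s))
    (fun _ _ => NMExt.sgn_eq_one_or _) hε (hεs.trans (by norm_num)) hkn (h.sum_abs_le hd)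
  have hnk : (1 : ℝ) ≤ (n : ℝ) - k := by
    have : (k : ℝ) + 1 ≤ n := by exact_mod_cast hkn
    linarith
  have h1 := NMExt.seed_length_bound hε hkn hD
  have h2 := NMExt.source_entropy_bound hε (hεs.trans (by norm_num)) hd ht
    (NMExt.mul_le_of_nonMalleable hε hεs h hkn hd ht htd (hnk.trans hD))
  exact ⟨h1, h2, fun hn => NMExt.loglog_bound hε hε' ht hn h1 h2⟩
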